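/- Let $u_+\le 0$. For $u_-<u_+$ put $\delta:=|u_--u_+|$ and consider the stationary problem on the half line $$\Big(\tfrac12\bar u^2\Big)_x=-\bar q_x,\qquad -\bar q_{xx}+\bar q+\bar u_x=0\quad(x\ge 0),\qquad \bar u(0)=u_-,\quad \bar u(+\infty)=u_+,\quad \bar q(+\infty)=0.$$ There are a constant $\lambda>0$ depending only on $u_+$ and, for every $u_-<u_+$, a classical solution $(\bar u,\bar q)$ of this problem, with $\bar u\in C^4([0,\infty))$ and $\bar q\in C^2([0,\infty))$ (derivatives at $0$ being one-sided), such that (i) $\bar u_x(x)>0$ for all $x\ge 0$, and such that, for every $M>0$, there is a constant $C>0$ depending only on $u_+$ and $M$ for which, whenever $u_-<u_+$ and $\delta\le M$, the following estimates hold for all $x\ge 0$: (ii) if $u_+<0$, then $\left|\partial_x^k\{\bar u(x)-u_+\}\right|\le C\delta\, e^{-\lambda x}$ for $k=0,1,2,3$; (iii) if $u_+=0$, then $\displaystyle |\partial_x^k\bar u(x)|\le C\,\frac{\delta^{k+1}}{(1+\delta x)^{k+1}}$ for $k=0,1,2,3,4$; (iv) $\displaystyle \left|\frac{\bar u_{xx}^2}{\bar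 u_x}\right|\le C\delta$ and $\displaystyle \left|\frac{\bar u_{xxx}^2}{\bar u_x}\right|\le C\delta$ (both for $u_+<0$ and for $u_+=0$); (v) if $u_+=0$, then $\displaystyle \left|\frac{\bar u_{xxx}}{\bar u_x}\right|\le C\delta$ and $\displaystyle \left|\frac{\partial_x^4\bar u}{\bar u_x}\right|\le C\delta$. -/

import Mathlib

/-- The `k`-th derivative of `w` on the closed half line `[0, ∞)` (one-sided at `0`). -/
noncomputable def halfLineDeriv (k : ℕ) (w : ℝ → ℝ) (x : ℝ) : ℝ :=
  iteratedDerivWithin k w (Set.Ici 0) x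

/-- `(u, q)` is a classical solution on `[0, ∞)` of the stationary problem
`(u ^ 2 / 2)_x = - q_x`, `- q_xx + q + u_x = 0`, `u 0 = um`, `u (+∞) = up`, `q (+∞) = 0`.
Values of `u` and `q` at negative arguments play no role. -/
structure IsStationarySolution (um up : ℝ) (u q : ℝ → ℝ) : Prop where
  contDiffOn_u : ContDiffOn ℝ 1 u (Set.Ici 0)
  contDiffOn_q : ContDiffOn ℝ 2 q (Set.Ici 0)
  conservation : ∀ x : ℝ, 0 ≤ x →
    halfLineDeriv 1 (fun y => u y ^ 2 / 2) x = - halfLineDeriv 1 q x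
  elliptic : ∀ x : ℝ, 0 ≤ x →
    - halfLineDeriv 2 q x + q x + halfLineDeriv 1 u x = 0
  boundary : u 0 = um
  farField_u : Filter.Tendsto u Filter.atTop (nhds up)
  farField_q : Filter.Tendsto q Filter.atTop (nhds 0)

open Set Filter Topology

/-! Write u₊ = -m, y = u₊ - ū and w = ū_x = -y_x. The conservation law integrates to q = -y(y+2m)/2,
so p := q_x = (y+m)w, and the elliptic equation reads p_x = w - y(y+2m)/2. With y as independent
variable, multiplication by y+m gives p dp/dy = g(y) - p, where g(y) = (y+m)y(y+2m)/2. Hence E =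
p²/2 solves E' = g - √(2E), E(0) = 0.

The right side is not Lipschitz at E = 0, but it is nonincreasing in E, and this is all that
comparison needs. It yields existence (`exists_sqrt_ode_solution`) and lets explicit barriers bound
p (`IsStableCurve.le_sqrt`, `IsStableCurve.sqrt_le`). The profile is then recovered from the scalar
equation y_x = -p/(y+m) (`exists_decreasing_trajectory`).

For m > 0 quadratic barriers make w comparable to y, hence exponential decay. For m = 0 one has p ≈
y³/2, so w ≈ y²/2 and y decays like 1/x. Higher derivatives are rational in (y, w). When m = 0 each
differentiation divides by y, and the order y^(k+1) of the k-th derivative survives only through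
cancellation; this requires w = y²/2 - 3y⁴/4 + 3y⁶ + O(y⁸) (`IsStableCurve.exists_expansion`). The
estimates follow on dividing by the lower bound for w. -/

/-- A function that starts nonpositive and does not increase where it is positive stays
nonpositive. -/
theorem nonpos_of_deriv_nonpos_of_pos {f f' : ℝ → ℝ} {b : ℝ}
    (hf : ContinuousOn f (Icc 0 b)) (h0 : f 0 ≤ 0)
    (hd : ∀ y ∈ Ioo 0 b, HasDerivAt f (f' y) y)
    (hneg : ∀ y ∈ Ioo 0 b, 0 < f y → f' y ≤ 0) {t : ℝ} (ht : t ∈ Icc 0 b) : f t ≤ 0 := by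
  by_contra! hpos
  -- The last point before `t` with `f ≤ 0`; after it `f` is positive, hence nonincreasing.
  set S : Set ℝ := Icc 0 t ∩ f ⁻¹' Iic 0 with hS
  have hft : ContinuousOn f (Icc 0 t) := hf.mono (Icc_subset_Icc_right ht.2)
  have hSc : IsClosed S := hft.preimage_isClosed_of_isClosed isClosed_Icc isClosed_Iic
  have hSne : S.Nonempty := ⟨0, ⟨le_rfl, ht.1⟩, h0⟩
  have hSb : BddAbove S := ⟨t, fun x hx => hx.1.2⟩
  have hsS : sSup S ∈ S := hSc.csSup_mem hSne hSb
  set s := sSup S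
  have hst : s ≤ t := hsS.1.2
  have hgt : ∀ x ∈ Ioo s t, 0 < f x := by
    intro x hx
    by_contra! hx0
    exact absurd (le_csSup hSb (show x ∈ S from ⟨⟨hsS.1.1.trans hx.1.le, hx.2.le⟩, hx0⟩))
      (not_le.2 hx.1)
  have hanti : AntitoneOn f (Icc s t) := by
    refine antitoneOn_of_deriv_nonpos (convex_Icc s t)
      (hft.mono (Icc_subset_Icc_left hsS.1.1)) ?_ ?_
    · rw [interior_Icc]
      intro x hx
      exact (hd x ⟨hsS.1.1.trans_lt hx.1, hx.2.trans_le ht.2⟩).differentiableAt.differentiableWithinAt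
    · rw [interior_Icc]
      intro x hx
      have hx' : x ∈ Ioo 0 b := ⟨hsS.1.1.trans_lt hx.1, hx.2.trans_le ht.2⟩
      rw [(hd x hx').deriv]
      exact hneg x hx' (hgt x hx)
  have h1 := hanti ⟨le_rfl, hst⟩ ⟨hst, le_rfl⟩ hst
  have h2 : f s ≤ 0 := hsS.2
  linarith

/-! ### The non-Lipschitz square-root equation -/

/-- A Lipschitz regularization of `E ↦ √(2E)`. -/
noncomputable def regSqrt (ε E : ℝ) : ℝ := √(2 * max E 0 + ε ^ 2) - ε

theorem regSqrt_mono {ε a b : ℝ} (h : a ≤ b) : regSqrt ε a ≤ regSqrt ε b := by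
  unfold regSqrt
  gcongr

theorem regSqrt_zero {ε E : ℝ} (hε : 0 ≤ ε) (hE : E ≤ 0) : regSqrt ε E = 0 := by
  simp [regSqrt, max_eq_right hE, Real.sqrt_sq hε]

theorem regSqrt_nonneg {ε E : ℝ} (hε : 0 ≤ ε) : 0 ≤ regSqrt ε E := by
  rcases le_total E 0 with h | h
  · rw [regSqrt_zero hε h]
  · rw [← regSqrt_zero hε le_rfl]; exact regSqrt_mono h

theorem abs_regSqrt_sub_le {ε a b : ℝ} (hε : 0 < ε) :
    |regSqrt ε a - regSqrt ε b| ≤ ε⁻¹ * |a - b| := by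
  wlog h : b ≤ a generalizing a b
  · rw [abs_sub_comm, abs_sub_comm a]; exact this (le_of_not_ge h)
  rw [abs_of_nonneg (sub_nonneg.2 (regSqrt_mono h)), abs_of_nonneg (sub_nonneg.2 h)]
  have hm : max a 0 - max b 0 ≤ a - b := by
    rcases max_cases a 0 with h1 | h1 <;> rcases max_cases b 0 with h2 | h2 <;> linarith
  have hA : ε ≤ √(2 * max a 0 + ε ^ 2) := Real.le_sqrt_of_sq_le (by simp)
  have hB : ε ≤ √(2 * max b 0 + ε ^ 2) := Real.le_sqrt_of_sq_le (by simp)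
  have hA2 := Real.sq_sqrt (show 0 ≤ 2 * max a 0 + ε ^ 2 by positivity)
  have hB2 := Real.sq_sqrt (show 0 ≤ 2 * max b 0 + ε ^ 2 by positivity)
  have hAB := regSqrt_mono (ε := ε) h
  unfold regSqrt at *
  set A := √(2 * max a 0 + ε ^ 2)
  set B := √(2 * max b 0 + ε ^ 2)
  rw [inv_mul_eq_div, le_div_iff₀ hε]
  nlinarith

theorem regSqrt_le_add {ε ε' E : ℝ} (h0 : 0 ≤ ε) :
    regSqrt ε E ≤ regSqrt ε' E + |ε - ε'| := by
  unfold regSqrt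
  set A := 2 * max E 0
  have hA : 0 ≤ A := by positivity
  rcases le_total ε ε' with h | h
  · rw [abs_of_nonpos (by linarith)]
    have : √(A + ε ^ 2) ≤ √(A + ε' ^ 2) := by gcongr
    linarith
  · rw [abs_of_nonneg (by linarith)]
    have : √(A + ε ^ 2) ≤ √(A + ε' ^ 2) + (ε - ε') := by
      rw [Real.sqrt_le_left (by positivity)]
      have h1 : ε' ≤ √(A + ε' ^ 2) := Real.le_sqrt_of_sq_le (by linarith)
      have h2 := Real.sq_sqrt (show 0 ≤ A + ε' ^ 2 by positivity)
      nlinarith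
    linarith

theorem abs_sqrt_sub_sqrt_le {a b : ℝ} (ha : 0 ≤ a) (hb : 0 ≤ b) :
    |√a - √b| ≤ √|a - b| := by
  apply Real.le_sqrt_of_sq_le
  have h1 := Real.sq_sqrt ha
  have h2 := Real.sq_sqrt hb
  have : |√a - √b| ≤ √a + √b := by
    rw [abs_le]; constructor <;> linarith [Real.sqrt_nonneg a, Real.sqrt_nonneg b]
  calc |√a - √b| ^ 2 ≤ |√a - √b| * |√a + √b| := by
        rw [sq, abs_of_nonneg (show 0 ≤ √a + √b by positivity)]; gcongr
    _ = |a - b| := by rw [← abs_mul]; congr 1; nlinarith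

theorem exists_regularized_solution {g : ℝ → ℝ} {T ε : ℝ} (hT : 0 < T) (hε : 0 < ε)
    (hg : ContinuousOn g (Icc 0 T)) (hg0 : ∀ y ∈ Icc 0 T, 0 ≤ g y) :
    ∃ E : ℝ → ℝ, E 0 = 0 ∧ ContinuousOn E (Icc 0 T) ∧ (∀ y ∈ Icc 0 T, 0 ≤ E y) ∧
      ∀ y ∈ Ioo 0 T, HasDerivAt E (g y - regSqrt ε (E y)) y := by
  obtain ⟨G, hG⟩ := isCompact_Icc.exists_bound_of_continuousOn hg
  have hGn : 0 ≤ G := (norm_nonneg _).trans (hG 0 ⟨le_rfl, hT.le⟩)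
  -- The radius 2(T+G)² does not depend on ε and is large enough that the speed bound G + 2(T+G)
  -- cannot leave the ball before time T, so no continuation argument is needed.
  have hPL : IsPicardLindelof (fun y E => g y - regSqrt ε E)
      (⟨0, le_rfl, hT.le⟩ : Icc (0 : ℝ) T) 0 ⟨2 * (T + G) ^ 2, by positivity⟩ 0
      ⟨G + 2 * (T + G), by positivity⟩ ⟨ε⁻¹, by positivity⟩ := by
    refine ⟨fun y _ => ?_, fun x _ => ?_, fun y hy E hE => ?_, ?_⟩
    · refine LipschitzOnWith.of_dist_le_mul fun a _ b _ => ?_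
      rw [Real.dist_eq, Real.dist_eq]
      have := abs_regSqrt_sub_le (a := b) (b := a) hε
      rw [abs_sub_comm b a] at this
      rw [sub_sub_sub_cancel_left]
      exact this
    · exact hg.sub continuousOn_const
    · have hE' : |E| ≤ 2 * (T + G) ^ 2 := mem_closedBall_zero_iff.1 hE
      have h1 : regSqrt ε E ≤ 2 * (T + G) := by
        unfold regSqrt
        rw [sub_le_iff_le_add, Real.sqrt_le_left (by positivity)]
        have : max E 0 ≤ 2 * (T + G) ^ 2 := max_le ((le_abs_self E).trans hE') (by positivity)
        nlinarith [mul_nonneg (add_nonneg hT.le hGn) hε.le]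
      have h2 := regSqrt_nonneg (E := E) hε.le
      calc ‖g y - regSqrt ε E‖ ≤ ‖g y‖ + ‖regSqrt ε E‖ := norm_sub_le _ _
        _ ≤ G + 2 * (T + G) := by
          gcongr
          · exact hG y hy
          · rwa [Real.norm_of_nonneg h2]
    · simp only [sub_zero, sub_self, max_eq_left hT.le, NNReal.coe_zero]
      change (G + 2 * (T + G)) * T ≤ 2 * (T + G) ^ 2
      nlinarith [mul_nonneg hT.le hGn, sq_nonneg G]
  obtain ⟨E, hE0, hE⟩ := hPL.exists_eq_forall_mem_Icc_hasDerivWithinAt₀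
  have hc : ContinuousOn E (Icc 0 T) := fun y hy => (hE y hy).continuousWithinAt
  have hd : ∀ y ∈ Ioo 0 T, HasDerivAt E (g y - regSqrt ε (E y)) y := fun y hy =>
    (hE y ⟨hy.1.le, hy.2.le⟩).hasDerivAt (Icc_mem_nhds hy.1 hy.2)
  refine ⟨E, hE0, hc, fun y hy => ?_, hd⟩
  have hE0' : E 0 = 0 := hE0
  have := nonpos_of_deriv_nonpos_of_pos (f := fun y => -E y) hc.neg (by simp [hE0'])
    (fun y hy => (hd y hy).neg) (fun y hy hpos => by
      rw [regSqrt_zero hε.le (by linarith)]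
      linarith [hg0 y ⟨hy.1.le, hy.2.le⟩]) hy
  linarith

/-- Where `E` exceeds `E'`, monotonicity of the damping gives the difference the right sign, and
only the change of ε contributes. The bound contains no Lipschitz constant, so it survives ε → 0. -/
theorem regularized_solution_le {g E E' : ℝ → ℝ} {T ε ε' : ℝ} (hε' : 0 < ε')
    (h0 : E 0 = 0) (h0' : E' 0 = 0) (hc : ContinuousOn E (Icc 0 T))
    (hc' : ContinuousOn E' (Icc 0 T))
    (hd : ∀ y ∈ Ioo 0 T, HasDerivAt E (g y - regSqrt ε (E y)) y)
    (hd' : ∀ y ∈ Ioo 0 T, HasDerivAt E' (g y - regSqrt ε' (E' y)) y)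
    {y : ℝ} (hy : y ∈ Icc 0 T) : E y ≤ E' y + |ε - ε'| * T := by
  have := nonpos_of_deriv_nonpos_of_pos (f := fun y => E y - E' y - |ε - ε'| * y)
    ((hc.sub hc').sub (by fun_prop)) (by simp [h0, h0'])
    (fun y hy => ((hd y hy).sub (hd' y hy)).sub ((hasDerivAt_id y).const_mul |ε - ε'|))
    (fun y hy hpos => by
      have h1 : E' y ≤ E y := by nlinarith [abs_nonneg (ε - ε'), hy.1]
      have h2 := regSqrt_mono (ε := ε) h1
      have h3 := regSqrt_le_add (E := E' y) (ε' := ε) hε'.le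
      rw [abs_sub_comm] at h3
      linarith) hy
  have h4 : |ε - ε'| * y ≤ |ε - ε'| * T := by gcongr; exact hy.2
  linarith

/-- Solvability of `E' = g - √(2E)`, `E 0 = 0`, where the right-hand side is not Lipschitz. -/
theorem exists_sqrt_ode_solution {g : ℝ → ℝ} {T : ℝ} (hT : 0 < T)
    (hg : ContinuousOn g (Icc 0 T)) (hg0 : ∀ y ∈ Icc 0 T, 0 ≤ g y) :
    ∃ E : ℝ → ℝ, E 0 = 0 ∧ ContinuousOn E (Icc 0 T) ∧ (∀ y ∈ Icc 0 T, 0 ≤ E y) ∧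
      ∀ y ∈ Ioo 0 T, HasDerivAt E (g y - √(2 * E y)) y := by
  have hε : ∀ n : ℕ, 0 < 1 / ((n : ℝ) + 1) := fun n => by positivity
  set ε : ℕ → ℝ := fun n => 1 / ((n : ℝ) + 1) with hεdef
  have hεlim : Tendsto ε atTop (𝓝 0) := tendsto_one_div_add_atTop_nhds_zero_nat
  choose F hF0 hFc hFn hFd using fun n => exists_regularized_solution hT (hε n) hg hg0
  have hab : ∀ i j, ∀ y ∈ Icc 0 T, |F i y - F j y| ≤ |ε i - ε j| * T := fun i j y hy => by
    have h1 := regularized_solution_le (hε j) (hF0 i) (hF0 j) (hFc i) (hFc j)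
      (hFd i) (hFd j) hy
    have h2 := regularized_solution_le (hε i) (hF0 j) (hF0 i) (hFc j) (hFc i)
      (hFd j) (hFd i) hy
    rw [abs_sub_comm] at h2
    rw [abs_le]; constructor <;> linarith
  have hcau : ∀ y ∈ Icc 0 T, CauchySeq fun n => F n y := by
    intro y hy
    have hεc := hεlim.cauchySeq
    rw [Metric.cauchySeq_iff] at hεc ⊢
    intro r hr
    obtain ⟨N, hN⟩ := hεc (r / T) (by positivity)
    refine ⟨N, fun i hi j hj => (hab i j y hy).trans_lt ?_⟩
    rw [← lt_div_iff₀ hT]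
    exact hN i hi j hj
  have hlim : ∀ y : ℝ, ∃ l, y ∈ Icc 0 T → Tendsto (fun n => F n y) atTop (𝓝 l) := fun y => by
    by_cases hy : y ∈ Icc 0 T
    · obtain ⟨l, hl⟩ := cauchySeq_tendsto_of_complete (hcau y hy)
      exact ⟨l, fun _ => hl⟩
    · exact ⟨0, fun h => absurd h hy⟩
  choose E hE using hlim
  have hbd : ∀ n, ∀ y ∈ Icc 0 T, |F n y - E y| ≤ ε n * T := fun n y hy => by
    have h1 : Tendsto (fun j => |F n y - F j y|) atTop (𝓝 |F n y - E y|) :=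
      (tendsto_const_nhds.sub (hE y hy)).abs
    have h2 : Tendsto (fun j => |ε n - ε j| * T) atTop (𝓝 (|ε n - 0| * T)) :=
      ((tendsto_const_nhds.sub hεlim).abs).mul_const T
    have h3 := le_of_tendsto_of_tendsto' h1 h2 fun j => hab n j y hy
    rwa [sub_zero, abs_of_pos (hε n)] at h3
  have hEn : ∀ y ∈ Icc 0 T, 0 ≤ E y := fun y hy =>
    ge_of_tendsto' (hE y hy) fun n => hFn n y hy
  have hunif : TendstoUniformlyOn F E atTop (Icc 0 T) := by
    rw [Metric.tendstoUniformlyOn_iff]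
    intro r hr
    have h1 : Tendsto (fun n => ε n * T) atTop (𝓝 0) := by simpa using hεlim.mul_const T
    filter_upwards [h1.eventually (gt_mem_nhds hr)] with n hn y hy
    rw [dist_comm]
    exact (hbd n y hy).trans_lt hn
  have hunif' : TendstoUniformlyOn (fun n y => g y - regSqrt (ε n) (F n y))
      (fun y => g y - √(2 * E y)) atTop (Ioo 0 T) := by
    rw [Metric.tendstoUniformlyOn_iff]
    intro r hr
    -- Hölder continuity of the root with exponent 1/2 turns the rate εT for the solutions into this
    -- rate for their derivatives.
    have h1 : Tendsto (fun n => √(2 * (ε n * T) + ε n ^ 2) + ε n) atTop (𝓝 0) := by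
      have : Tendsto (fun n => √(2 * (ε n * T) + ε n ^ 2) + ε n) atTop
          (𝓝 (√(2 * (0 * T) + 0 ^ 2) + 0)) :=
        ((((hεlim.mul_const T).const_mul 2).add (hεlim.pow 2)).sqrt).add hεlim
      simpa using this
    filter_upwards [h1.eventually (gt_mem_nhds hr)] with n hn y hy
    have hy' : y ∈ Icc 0 T := ⟨hy.1.le, hy.2.le⟩
    refine lt_of_le_of_lt ?_ hn
    have hFy := hFn n y hy'
    have hEy := hEn y hy'
    rw [Real.dist_eq, sub_sub_sub_cancel_left, regSqrt, max_eq_left hFy, sub_right_comm]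
    have h2 := abs_sqrt_sub_sqrt_le (a := 2 * F n y + ε n ^ 2) (b := 2 * E y) (by positivity)
      (by positivity)
    have h3 : √|2 * F n y + ε n ^ 2 - 2 * E y| ≤ √(2 * (ε n * T) + ε n ^ 2) := by
      apply Real.sqrt_le_sqrt
      have := abs_le.1 (hbd n y hy')
      rw [abs_le]; constructor <;> nlinarith [sq_nonneg (ε n)]
    calc |√(2 * F n y + ε n ^ 2) - √(2 * E y) - ε n|
        ≤ |√(2 * F n y + ε n ^ 2) - √(2 * E y)| + |ε n| := abs_sub _ _
      _ ≤ _ := by rw [abs_of_pos (hε n)]; gcongr; exact h2.trans h3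
  refine ⟨E, ?_, hunif.continuousOn (Frequently.of_forall hFc), hEn, fun y hy => ?_⟩
  · exact tendsto_nhds_unique (hE 0 ⟨le_rfl, hT.le⟩) (by simp [hF0])
  · exact hasDerivAt_of_tendstoUniformlyOn isOpen_Ioo hunif'
      (Eventually.of_forall fun n => hFd n)
      (fun x hx => hE x ⟨hx.1.le, hx.2.le⟩) hy

/-! ### The stable curve in the phase plane and its barriers -/

/-- `E` is the kinetic energy `p ^ 2 / 2` along the stable curve of the stationary problem in the
phase plane, as a function of the distance `y` to the far-field state `-m`. -/
structure IsStableCurve (m T : ℝ) (E : ℝ → ℝ) : Prop where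
  zero : E 0 = 0
  continuousOn : ContinuousOn E (Icc 0 T)
  nonneg : ∀ y ∈ Icc 0 T, 0 ≤ E y
  hasDerivAt : ∀ y ∈ Ioo 0 T,
    HasDerivAt E ((y + m) * (y * (y + 2 * m) / 2) - √(2 * E y)) y

theorem exists_isStableCurve {m T : ℝ} (hm : 0 ≤ m) (hT : 0 < T) :
    ∃ E, IsStableCurve m T E := by
  obtain ⟨E, h1, h2, h3, h4⟩ := exists_sqrt_ode_solution
    (g := fun y => (y + m) * (y * (y + 2 * m) / 2)) hT (by fun_prop)
    (fun y hy => by have := hy.1; positivity)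
  exact ⟨E, h1, h2, h3, h4⟩

namespace IsStableCurve

variable {m T b : ℝ} {E P P' : ℝ → ℝ}

/-- Comparison is made between the energies P²/2 and E rather than between P and p, so nothing is
divided by p, which vanishes at 0. Where P²/2 > E, also P ≥ √(2E), and the subsolution inequality
makes the difference nonincreasing. -/
theorem le_sqrt (hE : IsStableCurve m T E) (hb : b ≤ T) (hP0 : P 0 = 0)
    (hP : ∀ y, HasDerivAt P (P' y) y) (hPn : ∀ y ∈ Ioo 0 b, 0 ≤ P y)
    (hPP : ∀ y ∈ Ioo 0 b, P y * P' y ≤ (y + m) * (y * (y + 2 * m) / 2) - P y)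
    {y : ℝ} (hy : y ∈ Icc 0 b) : P y ≤ √(2 * E y) := by
  have hPc : Continuous P := continuous_iff_continuousAt.2 fun y => (hP y).continuousAt
  have := nonpos_of_deriv_nonpos_of_pos (f := fun y => P y ^ 2 / 2 - E y) (b := b)
    (((hPc.pow 2).div_const 2).continuousOn.sub
      (hE.continuousOn.mono (Icc_subset_Icc_right hb))) (by simp [hP0, hE.zero])
    (fun y hy => (((hP y).pow 2).div_const 2).sub
      (hE.hasDerivAt y ⟨hy.1, hy.2.trans_le hb⟩))
    (fun y hy hpos => by
      have h1 : √(2 * E y) ≤ P y := by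
        rw [Real.sqrt_le_left (hPn y hy)]; linarith
      have h2 := hPP y hy
      generalize √(2 * E y) = S at *
      norm_num
      linarith) hy
  exact Real.le_sqrt_of_sq_le (by linarith)

theorem sqrt_le (hE : IsStableCurve m T E) (hb : b ≤ T) (hP0 : P 0 = 0)
    (hP : ∀ y, HasDerivAt P (P' y) y) (hPn : ∀ y ∈ Icc 0 b, 0 ≤ P y)
    (hPP : ∀ y ∈ Ioo 0 b, (y + m) * (y * (y + 2 * m) / 2) - P y ≤ P y * P' y)
    {y : ℝ} (hy : y ∈ Icc 0 b) : √(2 * E y) ≤ P y := by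
  have hPc : Continuous P := continuous_iff_continuousAt.2 fun y => (hP y).continuousAt
  have := nonpos_of_deriv_nonpos_of_pos (f := fun y => E y - P y ^ 2 / 2) (b := b)
    ((hE.continuousOn.mono (Icc_subset_Icc_right hb)).sub
      ((hPc.pow 2).div_const 2).continuousOn) (by simp [hP0, hE.zero])
    (fun y hy => (hE.hasDerivAt y ⟨hy.1, hy.2.trans_le hb⟩).sub
      (((hP y).pow 2).div_const 2))
    (fun y hy hpos => by
      have h1 : P y ≤ √(2 * E y) := Real.le_sqrt_of_sq_le (by linarith)
      have h2 := hPP y hy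
      generalize √(2 * E y) = S at *
      norm_num
      linarith) hy
  rw [Real.sqrt_le_left (hPn y hy)]
  linarith

theorem hasDerivAt_quadratic (l m y : ℝ) :
    HasDerivAt (fun y => l * (y * (y + m))) (l * (2 * y + m)) y := by
  have := (((hasDerivAt_id y).mul ((hasDerivAt_id y).add_const m))).const_mul l
  refine this.congr_deriv ?_
  simp only [id]; ring

theorem sqrt_le_quadratic (hE : IsStableCurve m T E) (hm : 0 ≤ m) {y : ℝ} (hy : y ∈ Icc 0 T) :
    √(2 * E y) ≤ y * (y + m) := by
  have := hE.sqrt_le le_rfl (by simp) (hasDerivAt_quadratic 1 m)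
    (fun y hy => by have := hy.1; positivity)
    (fun y hy => by
      have := hy.1
      have h : 0 ≤ y * (y + m) * (1 + (3 / 2) * y) := by positivity
      nlinarith) hy
  simpa using this

theorem quadratic_le_sqrt (hE : IsStableCurve m T E) (hm : 0 < m) {y : ℝ} (hy : y ∈ Icc 0 T) :
    min (1 / 2) (m / 2) * (y * (y + m)) ≤ √(2 * E y) := by
  set l := min (1 / 2) (m / 2) with hl
  have hl0 : 0 < l := by positivity
  have hl1 : l ≤ 1 / 2 := min_le_left _ _
  have hl2 : l ≤ m / 2 := min_le_right _ _
  refine hE.le_sqrt le_rfl (by simp) (hasDerivAt_quadratic l m)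
    (fun y hy => by have := hy.1; positivity)
    (fun y hy => ?_) hy
  have hy0 := hy.1
  -- The subsolution inequality divided by y(y+m): l ≤ 1/2 absorbs 2l²y into y/2 and l²m into m/4,
  -- and l ≤ m/2 handles the last term.
  have h1 : l ^ 2 * (2 * y + m) + l ≤ (y + 2 * m) / 2 := by
    have : l ^ 2 ≤ 1 / 4 := by nlinarith
    nlinarith
  have h2 := mul_le_mul_of_nonneg_left h1 (show 0 ≤ y * (y + m) by positivity)
  linarith

theorem hasDerivAt_cubic (l y : ℝ) : HasDerivAt (fun y => l * y ^ 3) (l * (3 * y ^ 2)) y := by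
  simpa using (hasDerivAt_pow 3 y).const_mul l

theorem sqrt_le_cubic (hE : IsStableCurve 0 T E) {y : ℝ} (hy : y ∈ Icc 0 T) :
    √(2 * E y) ≤ 1 / 2 * y ^ 3 := by
  refine hE.sqrt_le le_rfl (by simp) (hasDerivAt_cubic (1 / 2))
    (fun y hy => by have := hy.1; positivity)
    (fun y hy => ?_) hy
  have := hy.1
  have h : 0 ≤ 1 / 2 * y ^ 3 * (1 / 2 * (3 * y ^ 2)) := by positivity
  linarith

theorem cubic_le_sqrt (hE : IsStableCurve 0 T E) {l : ℝ} (hl : 0 ≤ l)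
    (hlT : 3 * l ^ 2 * T ^ 2 + l ≤ 1 / 2) {y : ℝ} (hy : y ∈ Icc 0 T) :
    l * y ^ 3 ≤ √(2 * E y) := by
  refine hE.le_sqrt le_rfl (by simp) (hasDerivAt_cubic l)
    (fun y hy => by have := hy.1; positivity)
    (fun y hy => ?_) hy
  have hy0 := hy.1
  have h1 : 3 * l ^ 2 * y ^ 2 + l ≤ 1 / 2 := by
    refine le_trans ?_ hlT
    have := hy.2
    gcongr
  have h2 := mul_le_mul_of_nonneg_left h1 (show 0 ≤ y ^ 3 by positivity)
  linarith

theorem hasDerivAt_nonic (k y : ℝ) :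
    HasDerivAt (fun y => y ^ 3 / 2 - 3 / 4 * y ^ 5 + 3 * y ^ 7 + k * y ^ 9)
      (3 * y ^ 2 / 2 - 3 / 4 * (5 * y ^ 4) + 3 * (7 * y ^ 6) + k * (9 * y ^ 8)) y := by
  have := ((((hasDerivAt_pow 3 y).div_const 2).sub
    ((hasDerivAt_pow 5 y).const_mul (3 / 4))).add ((hasDerivAt_pow 7 y).const_mul 3)).add
    ((hasDerivAt_pow 9 y).const_mul k)
  norm_num at this
  exact this

/-- The coefficients 1/2, -3/4, 3 solve P P' = y³/2 - P through order y⁷. At order y⁹, P P'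
contributes 285/16 < 20, so a last coefficient -20 gives a subsolution and +20 a supersolution; y ≤
1/2 controls the higher orders. -/
theorem nonic_le_sqrt (hE : IsStableCurve 0 T E) {y : ℝ} (hy : y ∈ Icc 0 T) (hy1 : y ≤ 1 / 2) :
    y ^ 3 / 2 - 3 / 4 * y ^ 5 + 3 * y ^ 7 + (-20) * y ^ 9 ≤ √(2 * E y) := by
  refine hE.le_sqrt hy.2 (by simp) (hasDerivAt_nonic (-20)) (fun z hz => ?_) (fun z hz => ?_)
    ⟨hy.1, le_rfl⟩
  · have hz0 := hz.1
    have hs : z ^ 2 ≤ 1 / 4 := by nlinarith [hz.2]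
    have h : 0 ≤ 1 / 2 - 3 / 4 * z ^ 2 + 3 * (z ^ 2) ^ 2 - 20 * (z ^ 2) ^ 3 := by
      set s := z ^ 2
      have : 0 ≤ s := by positivity
      nlinarith [mul_nonneg this (sub_nonneg.2 hs), mul_nonneg (sq_nonneg s) (sub_nonneg.2 hs)]
    have := mul_nonneg (pow_nonneg hz0.le 3) h
    linarith
  · have hz0 := hz.1
    have hs : z ^ 2 ≤ 1 / 4 := by nlinarith [hz.2]
    have h : 0 ≤ 35 / 16 + 147 * z ^ 2 - 273 * (z ^ 2) ^ 2 + 960 * (z ^ 2) ^ 3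
        - 3600 * (z ^ 2) ^ 4 := by
      set s := z ^ 2
      have : 0 ≤ s := by positivity
      nlinarith [mul_nonneg this (sub_nonneg.2 hs), mul_nonneg (pow_nonneg this 3) (sub_nonneg.2 hs)]
    have := mul_nonneg (pow_nonneg hz0.le 9) h
    linarith

theorem sqrt_le_nonic (hE : IsStableCurve 0 T E) {y : ℝ} (hy : y ∈ Icc 0 T) (hy1 : y ≤ 1 / 2) :
    √(2 * E y) ≤ y ^ 3 / 2 - 3 / 4 * y ^ 5 + 3 * y ^ 7 + 20 * y ^ 9 := by
  refine hE.sqrt_le hy.2 (by simp) (hasDerivAt_nonic 20) (fun z hz => ?_) (fun z hz => ?_)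
    ⟨hy.1, le_rfl⟩
  · have hz0 := hz.1
    have hs : z ^ 2 ≤ 1 / 4 := by nlinarith [hz.2]
    have h : 0 ≤ 1 / 2 - 3 / 4 * z ^ 2 + 3 * (z ^ 2) ^ 2 + 20 * (z ^ 2) ^ 3 := by
      have : 0 ≤ 3 * (z ^ 2) ^ 2 + 20 * (z ^ 2) ^ 3 := by positivity
      linarith
    have := mul_nonneg (pow_nonneg hz0 3) h
    linarith
  · have hz0 := hz.1
    have hs : z ^ 2 ≤ 1 / 4 := by nlinarith [hz.2]
    have h : 0 ≤ 605 / 16 + 93 * z ^ 2 - 147 * (z ^ 2) ^ 2 + 960 * (z ^ 2) ^ 3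
        + 3600 * (z ^ 2) ^ 4 := by
      have : 0 ≤ 960 * (z ^ 2) ^ 3 + 3600 * (z ^ 2) ^ 4 := by positivity
      nlinarith [sq_nonneg z]
    have := mul_nonneg (pow_nonneg hz0.le 9) h
    linarith

theorem hasDerivAt_sqrt (hE : IsStableCurve m T E) {y : ℝ} (hy : y ∈ Ioo 0 T)
    (hpos : 0 < √(2 * E y)) :
    HasDerivAt (fun y => √(2 * E y))
      ((y + m) * (y * (y + 2 * m) / 2) / √(2 * E y) - 1) y := by
  have h0 : 2 * E y ≠ 0 := fun h => by simp [h] at hpos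
  refine (((hE.hasDerivAt y hy).const_mul 2).sqrt h0).congr_deriv ?_
  field_simp

end IsStableCurve

/-! ### From the phase curve to the profile -/

/-- The autonomous scalar equation `Y' = -V(Y)` with `0 < V y ≤ y` is solvable for all times, with
`Y` staying in `(0, δ]`. -/
theorem exists_decreasing_trajectory {V : ℝ → ℝ} {δ : ℝ} (hδ : 0 < δ)
    (hV : ContinuousOn V (Ioc 0 δ)) (hV0 : ∀ y ∈ Ioc 0 δ, 0 < V y ∧ V y ≤ y) :
    ∃ Y : ℝ → ℝ, Y 0 = δ ∧ ∀ x, 0 ≤ x → Y x ∈ Ioc 0 δ ∧ HasDerivAt Y (-V (Y x)) x := by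
  -- In the variable z = log Y, time is the integral of y / V(y). Freezing the argument at δ extends
  -- the integrand to all z, so the trajectory also exists for x < 0 and has a two-sided derivative
  -- at 0.
  set c : ℝ → ℝ := fun z => min (Real.exp z) δ with hc
  have hcc : Continuous c := Real.continuous_exp.min continuous_const
  have hcm : ∀ z, c z ∈ Ioc 0 δ := fun z => ⟨lt_min (Real.exp_pos z) hδ, min_le_right _ _⟩
  set r : ℝ → ℝ := fun z => c z / V (c z) with hr
  have hrc : Continuous r :=
    hcc.div (hV.comp_continuous hcc hcm) fun z => (hV0 _ (hcm z)).1.ne'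
  have hr1 : ∀ z, 1 ≤ r z := fun z => by
    rw [hr, one_le_div (hV0 _ (hcm z)).1]; exact (hV0 _ (hcm z)).2
  set τ : ℝ → ℝ := fun z => ∫ s in (Real.log δ)..z, r s with hτ
  have hτd : ∀ z, HasDerivAt τ (r z) z := fun z =>
    intervalIntegral.integral_hasDerivAt_right (hrc.intervalIntegrable _ _)
      (hrc.stronglyMeasurableAtFilter _ _) hrc.continuousAt
  have hτc : Continuous τ := continuous_iff_continuousAt.2 fun z => (hτd z).continuousAt
  -- Since V(y) ≤ y, time grows at least as fast as z; hence 0 is not reached in finite time.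
  have hmono : Monotone fun z => τ z - z :=
    monotone_of_hasDerivAt_nonneg (fun z => (hτd z).sub (hasDerivAt_id z))
      fun z => sub_nonneg.2 (hr1 z)
  have hτs : StrictMono τ := fun a b hab => by have := hmono hab.le; simp only at this; linarith
  have hτ0 : τ (Real.log δ) = 0 := by simp [hτ]
  have hsurj : Function.Surjective τ := by
    refine hτc.surjective ?_ ?_
    · refine tendsto_atTop_mono' _ ?_ (tendsto_atTop_add_const_right _ (-Real.log δ) tendsto_id)
      filter_upwards [eventually_ge_atTop (Real.log δ)] with z hz
      have := hmono hz
      simp only [hτ0] at this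
      simp only [id]; linarith
    · refine tendsto_atBot_mono' _ ?_ (tendsto_atBot_add_const_right _ (-Real.log δ) tendsto_id)
      filter_upwards [eventually_le_atBot (Real.log δ)] with z hz
      have := hmono hz
      simp only [hτ0] at this
      simp only [id]; linarith
  set e := hτs.orderIsoOfSurjective τ hsurj with he
  have hτe : ∀ x, τ (e.symm x) = x := fun x => e.apply_symm_apply x
  have hed : ∀ x, HasDerivAt e.symm (r (e.symm x))⁻¹ x := fun x =>
    HasDerivAt.of_local_left_inverse e.symm.continuous.continuousAt (hτd _)
      (by have := hr1 (e.symm x); positivity) (Eventually.of_forall hτe)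
  have he0 : e.symm 0 = Real.log δ := by
    apply hτs.injective; rw [hτe, hτ0]
  refine ⟨fun x => Real.exp (e.symm (-x)), ?_, fun x hx => ?_⟩
  · simp [he0, Real.exp_log hδ]
  · have hle : Real.exp (e.symm (-x)) ≤ δ := by
      rw [← Real.le_log_iff_exp_le hδ, ← he0]
      exact e.symm.monotone (by linarith)
    refine ⟨⟨Real.exp_pos _, hle⟩, ?_⟩
    have h1 := ((hed (-x)).scomp x (hasDerivAt_neg x)).exp
    refine h1.congr_deriv ?_
    have hcx : c (e.symm (-x)) = Real.exp (e.symm (-x)) := min_eq_left hle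
    have := Real.exp_pos (e.symm (-x))
    simp only [hr, hcx, Function.comp_apply, smul_eq_mul]
    field_simp

/-- `Y` is the distance of a stationary profile to the far-field state `-m`, and `W = -Y'` is its
slope; the last fields are bounds for the slope in terms of the distance. -/
structure IsProfile (m δ : ℝ) (Y W : ℝ → ℝ) : Prop where
  zero : Y 0 = δ
  pos : ∀ x, 0 ≤ x → 0 < Y x
  le : ∀ x, 0 ≤ x → Y x ≤ δ
  hasDerivAt : ∀ x, 0 ≤ x → HasDerivAt Y (-W x) x
  hasDerivAt_slope : ∀ x, 0 ≤ x →
    HasDerivAt W ((W x ^ 2 + W x - Y x * (Y x + 2 * m) / 2) / (Y x + m)) x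
  slope_le : ∀ x, 0 ≤ x → W x ≤ Y x
  le_slope : 0 < m → ∀ x, 0 ≤ x → min (1 / 2) (m / 2) * Y x ≤ W x
  le_slope_zero : m = 0 → ∀ x, 0 ≤ x → 1 / (4 * (δ + 1)) * Y x ^ 2 ≤ W x
  slope_expansion : m = 0 → ∀ x, 0 ≤ x → ∃ r : ℝ, |r| ≤ 56 ∧
    W x = Y x ^ 2 / 2 - 3 / 4 * Y x ^ 4 + 3 * Y x ^ 6 + r * Y x ^ 8

/-- With l = 1/(4T) the barrier condition reads 3/16 + 1/(4T) ≤ 1/2, which holds for T ≥ 1. It is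
applied with T = δ + 1. -/
theorem IsStableCurve.cubic_le_sqrt_of_le {T : ℝ} {E : ℝ → ℝ} (hE : IsStableCurve 0 T E)
    {y : ℝ} (hy : y ∈ Icc 0 T) : 1 / (4 * T) * y ^ 3 ≤ √(2 * E y) ∨ T < 1 := by
  rcases lt_or_ge T 1 with h | h
  · exact Or.inr h
  · refine Or.inl (hE.cubic_le_sqrt (by positivity) ?_ hy)
    have h1 : 3 * (1 / (4 * T)) ^ 2 * T ^ 2 = 3 / 16 := by field_simp; norm_num
    have h2 : 1 / (4 * T) ≤ 1 / 4 := by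
      apply one_div_le_one_div_of_le <;> linarith
    rw [h1]; linarith

theorem IsStableCurve.exists_expansion {T : ℝ} {E : ℝ → ℝ} (hE : IsStableCurve 0 T E)
    {y : ℝ} (hy : y ∈ Icc 0 T) (hy0 : 0 < y) : ∃ r : ℝ, |r| ≤ 56 ∧
      √(2 * E y) / y = y ^ 2 / 2 - 3 / 4 * y ^ 4 + 3 * y ^ 6 + r * y ^ 8 := by
  refine ⟨(√(2 * E y) / y - (y ^ 2 / 2 - 3 / 4 * y ^ 4 + 3 * y ^ 6)) / y ^ 8, ?_, by
    field_simp; ring⟩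
  have hy8 : 0 < y ^ 9 := by positivity
  rw [show (√(2 * E y) / y - (y ^ 2 / 2 - 3 / 4 * y ^ 4 + 3 * y ^ 6)) / y ^ 8
    = (√(2 * E y) - (y ^ 3 / 2 - 3 / 4 * y ^ 5 + 3 * y ^ 7)) / y ^ 9 by field_simp,
    abs_div, abs_of_pos hy8, div_le_iff₀ hy8, abs_le]
  rcases le_total y (1 / 2) with h | h
  · have h1 := hE.nonic_le_sqrt hy h
    have h2 := hE.sqrt_le_nonic hy h
    constructor <;> linarith
  -- Away from 0 the expansion carries no information: 0 ≤ p ≤ y³/2, and every power involved is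
  -- dominated by y⁹. The constant 56 = 32 + 12 + 12 comes from 64/2, 16·3/4 and 4·3.
  · have h1 := Real.sqrt_nonneg (2 * E y)
    have h2 := hE.sqrt_le_cubic hy
    have hs : 1 / 4 ≤ y ^ 2 := by nlinarith
    set s := y ^ 2 with hs_def
    have e1 : s ≤ 4 * s ^ 2 := by nlinarith
    have e2 : s ^ 2 ≤ 4 * s ^ 3 := by nlinarith [sq_nonneg s]
    have h0 : 1 ≤ 64 * s ^ 3 := by nlinarith
    have h3 : s ≤ 16 * s ^ 3 := by nlinarith
    have k1 := mul_le_mul_of_nonneg_left h0 (pow_pos hy0 3).le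
    have k2 := mul_le_mul_of_nonneg_left h3 (pow_pos hy0 3).le
    have k3 := mul_le_mul_of_nonneg_left e2 (pow_pos hy0 3).le
    have p5 : 0 ≤ y ^ 5 := by positivity
    have p7 : 0 ≤ y ^ 7 := by positivity
    have q1 : y ^ 3 * 1 ≤ 64 * y ^ 9 := by rw [hs_def] at k1; linarith
    have q2 : y ^ 5 ≤ 16 * y ^ 9 := by rw [hs_def] at k2; linarith
    have q3 : y ^ 7 ≤ 4 * y ^ 9 := by rw [hs_def] at k3; linarith
    constructor <;> linarith

theorem exists_isProfile {m δ : ℝ} (hm : 0 ≤ m) (hδ : 0 < δ) : ∃ Y W, IsProfile m δ Y W := by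
  -- The curve extends past δ so that the starting value y = δ is an interior point, where E is
  -- differentiable.
  obtain ⟨E, hE⟩ := exists_isStableCurve hm (T := δ + 1) (by linarith)
  have hsub : ∀ y ∈ Ioc 0 δ, y ∈ Ioo 0 (δ + 1) := fun y hy => ⟨hy.1, by linarith [hy.2]⟩
  have hsub' : ∀ y ∈ Ioc 0 δ, y ∈ Icc 0 (δ + 1) := fun y hy => ⟨hy.1.le, by linarith [hy.2]⟩
  have hlow : 0 < m → ∀ y ∈ Ioc 0 δ, min (1 / 2) (m / 2) * y ≤ √(2 * E y) / (y + m) := by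
    intro hm' y hy
    rw [le_div_iff₀ (by linarith [hy.1])]
    have := hE.quadratic_le_sqrt hm' (hsub' y hy)
    linarith
  have hlow0 : m = 0 → ∀ y ∈ Ioc 0 δ, 1 / (4 * (δ + 1)) * y ^ 2 ≤ √(2 * E y) / (y + m) := by
    intro hm' y hy
    subst hm'
    rw [le_div_iff₀ (by linarith [hy.1])]
    rcases hE.cubic_le_sqrt_of_le (hsub' y hy) with h | h
    · linarith
    · linarith
  have hWpos : ∀ y ∈ Ioc 0 δ, 0 < √(2 * E y) / (y + m) := by
    intro y hy
    have := hy.1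
    rcases hm.eq_or_lt with h | h
    · exact lt_of_lt_of_le (by positivity) (hlow0 h.symm y hy)
    · exact lt_of_lt_of_le (by positivity) (hlow h y hy)
  have hym : ∀ y ∈ Ioc 0 δ, 0 < y + m := fun y hy => by linarith [hy.1]
  have hppos : ∀ y ∈ Ioc 0 δ, 0 < √(2 * E y) := fun y hy => by
    have := mul_pos (hWpos y hy) (hym y hy)
    rwa [div_mul_cancel₀ _ (hym y hy).ne'] at this
  have hWle : ∀ y ∈ Ioc 0 δ, √(2 * E y) / (y + m) ≤ y := fun y hy => by
    rw [div_le_iff₀ (hym y hy)]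
    exact hE.sqrt_le_quadratic hm (hsub' y hy)
  obtain ⟨Y, hY0, hY⟩ := exists_decreasing_trajectory (V := fun y => √(2 * E y) / (y + m)) hδ
    (fun y hy => (((hE.hasDerivAt_sqrt (hsub y hy) (hppos y hy)).continuousAt).div
      (by fun_prop) (hym y hy).ne').continuousWithinAt)
    (fun y hy => ⟨hWpos y hy, hWle y hy⟩)
  refine ⟨Y, fun x => √(2 * E (Y x)) / (Y x + m), hY0, fun x hx => (hY x hx).1.1,
    fun x hx => (hY x hx).1.2, fun x hx => (hY x hx).2, fun x hx => ?_,
    fun x hx => hWle _ (hY x hx).1, fun h x hx => hlow h _ (hY x hx).1,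
    fun h x hx => hlow0 h _ (hY x hx).1, fun h x hx => ?_⟩
  · obtain ⟨hy, hd⟩ := hY x hx
    have hp := hppos _ hy
    have h1 := (hE.hasDerivAt_sqrt (hsub _ hy) hp).comp x hd
    have h2 := h1.div (hd.add_const m) (hym _ hy).ne'
    refine h2.congr_deriv ?_
    have := hym _ hy
    simp only [Function.comp_apply]
    generalize √(2 * E (Y x)) = p at *
    field_simp
    ring
  · subst h
    simpa using hE.exists_expansion (hsub' _ (hY x hx).1) (hY x hx).1.1

/-! ### Higher derivatives of the profile -/

/-- The second derivative of a profile in terms of distance and slope. -/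
noncomputable def profileD2 (m y w : ℝ) : ℝ := (w ^ 2 + w - y * (y + 2 * m) / 2) / (y + m)

/-- The third derivative of a profile in terms of distance and slope. -/
noncomputable def profileD3 (m y w : ℝ) : ℝ :=
  ((3 * w + 1) * profileD2 m y w + (y + m) * w) / (y + m)

/-- The fourth derivative of a profile in terms of distance and slope. -/
noncomputable def profileD4 (m y w : ℝ) : ℝ :=
  ((4 * w + 1) * profileD3 m y w + 3 * profileD2 m y w ^ 2 + (y + m) * profileD2 m y w - w ^ 2)
    / (y + m)

namespace IsProfile

variable {m δ : ℝ} {Y W : ℝ → ℝ}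

theorem add_pos (h : IsProfile m δ Y W) (hm : 0 ≤ m) {x : ℝ} (hx : 0 ≤ x) : 0 < Y x + m := by
  linarith [h.pos x hx]

theorem hasDerivAt_D2 (h : IsProfile m δ Y W) (hm : 0 ≤ m) {x : ℝ} (hx : 0 ≤ x) :
    HasDerivAt (fun x => profileD2 m (Y x) (W x)) (profileD3 m (Y x) (W x)) x := by
  have hY := h.hasDerivAt x hx
  have hW := h.hasDerivAt_slope x hx
  have hp := h.add_pos hm hx
  have := (((hW.pow 2).add hW).sub ((hY.mul (hY.add_const (2 * m))).div_const 2)).div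
    (hY.add_const m) hp.ne'
  refine this.congr_deriv ?_
  simp only [profileD3, profileD2, Pi.add_apply, Pi.sub_apply, Pi.pow_apply, Pi.mul_apply]
  generalize Y x = y at *
  generalize W x = w at *
  field_simp
  norm_num
  ring

theorem hasDerivAt_D3 (h : IsProfile m δ Y W) (hm : 0 ≤ m) {x : ℝ} (hx : 0 ≤ x) :
    HasDerivAt (fun x => profileD3 m (Y x) (W x)) (profileD4 m (Y x) (W x)) x := by
  have hY := h.hasDerivAt x hx
  have hW : HasDerivAt W (profileD2 m (Y x) (W x)) x := h.hasDerivAt_slope x hx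
  have hD := h.hasDerivAt_D2 hm hx
  have hp := h.add_pos hm hx
  have := ((((hW.const_mul 3).add_const 1).mul hD).add ((hY.add_const m).mul hW)).div
    (hY.add_const m) hp.ne'
  refine this.congr_deriv ?_
  simp only [profileD4, Pi.add_apply, Pi.mul_apply]
  have h3 : profileD3 m (Y x) (W x) * (Y x + m) =
      (3 * W x + 1) * profileD2 m (Y x) (W x) + (Y x + m) * W x := by
    rw [profileD3, div_mul_cancel₀ _ hp.ne']
  rw [← h3]
  field_simp
  ring

end IsProfile

theorem halfLineDeriv_eq {f : ℕ → ℝ → ℝ} {n : ℕ}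
    (h : ∀ k < n, ∀ x, 0 ≤ x → HasDerivAt (f k) (f (k + 1) x) x) :
    ∀ k ≤ n, ∀ x, 0 ≤ x → halfLineDeriv k (f 0) x = f k x := by
  intro k
  induction k with
  | zero => intro _ x _; simp [halfLineDeriv]
  | succ k ih =>
    intro hk x hx
    rw [halfLineDeriv, iteratedDerivWithin_succ]
    have h1 : EqOn (iteratedDerivWithin k (f 0) (Ici 0)) (f k) (Ici 0) :=
      fun z hz => ih (by omega) z hz
    rw [derivWithin_congr h1 (h1 hx)]
    exact (h k hk x hx).hasDerivWithinAt.derivWithin (uniqueDiffOn_Ici 0 x hx)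

theorem contDiffOn_of_hasDerivAt {f : ℕ → ℝ → ℝ} {n : ℕ}
    (h : ∀ k < n, ∀ x, 0 ≤ x → HasDerivAt (f k) (f (k + 1) x) x)
    (hc : ContinuousOn (f n) (Ici 0)) : ContDiffOn ℝ n (f 0) (Ici 0) := by
  have heq := halfLineDeriv_eq h
  have hE : ∀ k ≤ n, EqOn (iteratedDerivWithin k (f 0) (Ici 0)) (f k) (Ici 0) :=
    fun k hk x hx => heq k hk x hx
  refine contDiffOn_of_continuousOn_differentiableOn_deriv (n := (n : ℕ∞)) (fun k hk => ?_)
    (fun k hk => ?_)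
  · have hk' : k ≤ n := by exact_mod_cast hk
    refine ContinuousOn.congr ?_ (hE k hk')
    rcases hk'.eq_or_lt with rfl | hlt
    · exact hc
    · exact fun x hx => (h k hlt x hx).continuousAt.continuousWithinAt
  · have hk' : k < n := by exact_mod_cast hk
    refine DifferentiableOn.congr ?_ (hE k hk'.le)
    exact fun x hx => (h k hk' x hx).differentiableAt.differentiableWithinAt

/-- The successive derivatives of `c - Y` for a profile `Y` with slope `W`. -/
noncomputable def profileJet (m c : ℝ) (Y W : ℝ → ℝ) : ℕ → ℝ → ℝ
  | 0 => fun x => c - Y x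
  | 1 => W
  | 2 => fun x => profileD2 m (Y x) (W x)
  | 3 => fun x => profileD3 m (Y x) (W x)
  | 4 => fun x => profileD4 m (Y x) (W x)
  | _ => fun _ => 0

/-! ### Orders of the derivatives in terms of the distance -/

theorem exists_bound_of_mul_eq {A B : ℝ} {Q : ℝ × ℝ → ℝ}
    (hQ : ContinuousOn Q (Icc 0 A ×ˢ Icc (-B) B)) :
    ∃ C, 0 ≤ C ∧ ∀ y r, 0 < y → y ≤ A → |r| ≤ B → ∀ (k : ℕ) (z : ℝ), z = y ^ k * Q (y, r) →
      |z| ≤ C * y ^ k := by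
  obtain ⟨C, hC⟩ := (isCompact_Icc.prod isCompact_Icc).exists_bound_of_continuousOn hQ
  refine ⟨|C|, abs_nonneg C, fun y r hy hyA hr k z hz => ?_⟩
  have h := (hC (y, r) ⟨⟨hy.le, hyA⟩, abs_le.1 hr⟩).trans (le_abs_self C)
  rw [hz, abs_mul, abs_of_pos (pow_pos hy k), mul_comm]
  exact mul_le_mul_of_nonneg_right h (pow_pos hy k).le

/-- In the variables (y, w/y) a factor y splits off, and the remaining quotient is continuous on a
compact set because y + m ≥ m > 0. -/
theorem exists_profileD_bound_of_pos {m : ℝ} (hm : 0 < m) (M : ℝ) :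
    ∃ C, 0 ≤ C ∧ ∀ y w, 0 < y → y ≤ M → 0 ≤ w → w ≤ y →
      |profileD2 m y w| ≤ C * y ∧ |profileD3 m y w| ≤ C * y := by
  set Q2 : ℝ × ℝ → ℝ := fun z => (z.2 ^ 2 * z.1 + z.2 - (z.1 + 2 * m) / 2) / (z.1 + m)
  set Q3 : ℝ × ℝ → ℝ := fun z =>
    ((3 * (z.2 * z.1) + 1) * Q2 z + (z.1 + m) * z.2) / (z.1 + m)
  have hne : ∀ z ∈ Icc (0 : ℝ) M ×ˢ Icc (-1 : ℝ) 1, z.1 + m ≠ 0 := fun z hz => by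
    have := hz.1.1
    positivity
  have hQ2 : ContinuousOn Q2 (Icc 0 M ×ˢ Icc (-1) 1) := ContinuousOn.div (by fun_prop)
    (by fun_prop) hne
  have hQ3 : ContinuousOn Q3 (Icc 0 M ×ˢ Icc (-1) 1) := ContinuousOn.div (by fun_prop)
    (by fun_prop) hne
  obtain ⟨C2, hC2, h2⟩ := exists_bound_of_mul_eq hQ2
  obtain ⟨C3, hC3, h3⟩ := exists_bound_of_mul_eq hQ3
  refine ⟨C2 + C3, by positivity, fun y w hy hyM hw hwy => ?_⟩
  have hr : |w / y| ≤ 1 := by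
    rw [abs_of_nonneg (by positivity), div_le_one hy]; exact hwy
  have hym : y + m ≠ 0 := by positivity
  have e2 : profileD2 m y w = y ^ 1 * Q2 (y, w / y) := by
    simp only [Q2, profileD2]; field_simp
  have e3 : profileD3 m y w = y ^ 1 * Q3 (y, w / y) := by
    simp only [Q3, profileD3]; rw [e2]; field_simp
  have b2 := h2 y _ hy hyM hr 1 _ e2
  have b3 := h3 y _ hy hyM hr 1 _ e3
  rw [pow_one] at b2 b3
  constructor <;> nlinarith

/-- After substituting the expansion, all divisions by y cancel: each derivative is a power of y
times a polynomial in (y, r), which is bounded for bounded y and r. -/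
theorem exists_profileD_bound_of_zero (M : ℝ) :
    ∃ C, 0 ≤ C ∧ ∀ y w r, 0 < y → y ≤ M → |r| ≤ 56 →
      w = y ^ 2 / 2 - 3 / 4 * y ^ 4 + 3 * y ^ 6 + r * y ^ 8 →
      |w| ≤ C * y ^ 2 ∧ |profileD2 0 y w| ≤ C * y ^ 3 ∧ |profileD3 0 y w| ≤ C * y ^ 4 ∧
        |profileD4 0 y w| ≤ C * y ^ 5 := by
  set D : ℝ × ℝ → ℝ := fun z => 3 + z.2 * z.1 ^ 2
  set B : ℝ × ℝ → ℝ := fun z => -3 / 4 + z.1 ^ 2 * D z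
  set A : ℝ × ℝ → ℝ := fun z => 1 / 2 + z.1 ^ 2 * B z
  set G : ℝ × ℝ → ℝ := fun z => B z + z.1 ^ 2 * B z ^ 2 + D z
  set Q2 : ℝ × ℝ → ℝ := fun z => A z ^ 2 + B z
  -- The bracket is (Q2 + A)/y², polynomial because the constant terms 1/4 - 3/4 + 1/2 cancel.
  -- Likewise the bracket in `Q4` is (Q3 + B)/y², where -3/4 + 3/2 - 3/4 = 0.
  set Q3 : ℝ × ℝ → ℝ := fun z => 3 * A z * Q2 z + (2 * B z + z.1 ^ 2 * B z ^ 2 + D z)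
  set Q4 : ℝ × ℝ → ℝ := fun z => 4 * A z * Q3 z + 3 * Q2 z ^ 2 +
    (3 / 2 * G z + 3 * B z * Q2 z + 3 * D z + B z ^ 2 + z.2)
  have hA : Continuous A := by fun_prop
  have hQ2 : Continuous Q2 := by fun_prop
  have hQ3 : Continuous Q3 := by fun_prop
  have hQ4 : Continuous Q4 := by fun_prop
  obtain ⟨C1, hC1, h1⟩ := exists_bound_of_mul_eq (A := M) (B := 56) hA.continuousOn
  obtain ⟨C2, hC2, h2⟩ := exists_bound_of_mul_eq (A := M) (B := 56) hQ2.continuousOn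
  obtain ⟨C3, hC3, h3⟩ := exists_bound_of_mul_eq (A := M) (B := 56) hQ3.continuousOn
  obtain ⟨C4, hC4, h4⟩ := exists_bound_of_mul_eq (A := M) (B := 56) hQ4.continuousOn
  refine ⟨C1 + C2 + C3 + C4, by positivity, fun y w r hy hyM hr hw => ?_⟩
  have e1 : w = y ^ 2 * A (y, r) := by
    simp only [A, B, D]; rw [hw]; ring
  have e2 : profileD2 0 y w = y ^ 3 * Q2 (y, r) := by
    rw [profileD2, e1]
    simp only [Q2, A, B, D]
    field_simp
    ring
  have e3 : profileD3 0 y w = y ^ 4 * Q3 (y, r) := by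
    rw [profileD3, e2, e1]
    simp only [Q3, Q2, A, B, D]
    field_simp
    ring
  have e4 : profileD4 0 y w = y ^ 5 * Q4 (y, r) := by
    rw [profileD4, e3, e2, e1]
    simp only [Q4, Q3, Q2, G, A, B, D]
    field_simp
    ring
  refine ⟨(h1 y r hy hyM hr _ _ e1).trans ?_, (h2 y r hy hyM hr _ _ e2).trans ?_,
    (h3 y r hy hyM hr _ _ e3).trans ?_, (h4 y r hy hyM hr _ _ e4).trans ?_⟩ <;>
  · gcongr
    linarith

/-! ### Decay of the profile and the stationary system -/

namespace IsProfile

variable {m δ : ℝ} {Y W : ℝ → ℝ}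

theorem delta_pos (h : IsProfile m δ Y W) : 0 < δ := h.zero ▸ h.pos 0 le_rfl

theorem slope_pos (h : IsProfile m δ Y W) (hm : 0 ≤ m) {x : ℝ} (hx : 0 ≤ x) : 0 < W x := by
  have hy := h.pos x hx
  have hδ := h.delta_pos
  rcases hm.eq_or_lt with h0 | h0
  · exact lt_of_lt_of_le (by positivity) (h.le_slope_zero h0.symm x hx)
  · exact lt_of_lt_of_le (by positivity) (h.le_slope h0 x hx)

/-- Grönwall: Y' = -W ≤ -lY, so Y·exp(lx) is nonincreasing. -/
theorem le_exp (h : IsProfile m δ Y W) (hm : 0 < m) {x : ℝ} (hx : 0 ≤ x) :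
    Y x ≤ δ * Real.exp (-(min (1 / 2) (m / 2) * x)) := by
  set l := min (1 / 2) (m / 2)
  have hd : ∀ z, 0 ≤ z → HasDerivAt (fun z => Y z * Real.exp (l * z))
      (-W z * Real.exp (l * z) + Y z * (Real.exp (l * z) * (l * 1))) z := fun z hz =>
    (h.hasDerivAt z hz).mul ((hasDerivAt_id z).const_mul l).exp
  have hanti : AntitoneOn (fun z => Y z * Real.exp (l * z)) (Ici 0) := by
    refine antitoneOn_of_deriv_nonpos (convex_Ici 0)
      (fun z hz => (hd z hz).continuousAt.continuousWithinAt) ?_ ?_ <;> rw [interior_Ici]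
    · exact fun z hz => (hd z (le_of_lt hz)).differentiableAt.differentiableWithinAt
    · intro z hz
      rw [(hd z (le_of_lt hz)).deriv]
      have h1 := h.le_slope hm z (le_of_lt hz)
      have h2 := Real.exp_pos (l * z)
      nlinarith
  have := hanti (mem_Ici.2 le_rfl) (mem_Ici.2 hx) hx
  simp only [mul_zero, Real.exp_zero, mul_one, h.zero] at this
  rw [Real.exp_neg, ← div_eq_mul_inv, le_div_iff₀ (Real.exp_pos _)]
  exact this

/-- Riccati: (1/Y)' = W/Y² ≥ l, so 1/Y grows at least linearly. The free `l` allows one rate for all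
δ ≤ M. -/
theorem le_div_of_zero (h : IsProfile 0 δ Y W) {l : ℝ} (hl : 0 < l)
    (hlδ : l ≤ 1 / (4 * (δ + 1))) {x : ℝ} (hx : 0 ≤ x) : Y x ≤ δ / (1 + l * δ * x) := by
  have hδ := h.delta_pos
  have hd : ∀ z, 0 ≤ z → HasDerivAt (fun z => (Y z)⁻¹ - l * z) (-(-W z) / Y z ^ 2 - l * 1) z :=
    fun z hz => ((h.hasDerivAt z hz).inv (h.pos z hz).ne').sub ((hasDerivAt_id z).const_mul l)
  have hmono : MonotoneOn (fun z => (Y z)⁻¹ - l * z) (Ici 0) := by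
    refine monotoneOn_of_deriv_nonneg (convex_Ici 0)
      (fun z hz => (hd z hz).continuousAt.continuousWithinAt) ?_ ?_ <;> rw [interior_Ici]
    · exact fun z hz => (hd z (le_of_lt hz)).differentiableAt.differentiableWithinAt
    · intro z hz
      have hy := h.pos z (le_of_lt hz)
      rw [(hd z (le_of_lt hz)).deriv, neg_neg, mul_one, sub_nonneg, le_div_iff₀ (by positivity)]
      exact le_trans (by gcongr) (h.le_slope_zero rfl z (le_of_lt hz))
  have := hmono (mem_Ici.2 le_rfl) (mem_Ici.2 hx) hx
  simp only [mul_zero, sub_zero, h.zero] at this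
  have hy := h.pos x hx
  have h1 : (1 + l * δ * x) / δ ≤ (Y x)⁻¹ := by
    have : (1 + l * δ * x) / δ = δ⁻¹ + l * x := by field_simp
    linarith
  rw [le_inv_comm₀ (by positivity) hy, inv_div] at h1
  exact h1

theorem tendsto_zero (h : IsProfile m δ Y W) (hm : 0 ≤ m) : Tendsto Y atTop (𝓝 0) := by
  have hδ := h.delta_pos
  rcases hm.eq_or_lt with rfl | h0
  · refine tendsto_of_tendsto_of_tendsto_of_le_of_le'
      (h := fun x => δ / (1 + 1 / (4 * (δ + 1)) * δ * x)) tendsto_const_nhds ?_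
      (eventually_atTop.2 ⟨0, fun x hx => (h.pos x hx).le⟩)
      (eventually_atTop.2 ⟨0, fun x hx => h.le_div_of_zero (by positivity) le_rfl hx⟩)
    refine tendsto_const_nhds.div_atTop (tendsto_atTop_add_const_left _ _ ?_)
    exact tendsto_id.const_mul_atTop (by positivity)
  · refine tendsto_of_tendsto_of_tendsto_of_le_of_le'
      (h := fun x => δ * Real.exp (-(min (1 / 2) (m / 2) * x))) tendsto_const_nhds ?_
      (eventually_atTop.2 ⟨0, fun x hx => (h.pos x hx).le⟩)
      (eventually_atTop.2 ⟨0, fun x hx => h.le_exp h0 hx⟩)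
    have : Tendsto (fun x => min (1 / 2) (m / 2) * x) atTop atTop :=
      tendsto_id.const_mul_atTop (by positivity)
    simpa using (Real.tendsto_exp_neg_atTop_nhds_zero.comp this).const_mul δ

theorem hasDerivAt_jet (h : IsProfile m δ Y W) (hm : 0 ≤ m) (c : ℝ) :
    ∀ k < 4, ∀ x, 0 ≤ x →
      HasDerivAt (profileJet m c Y W k) (profileJet m c Y W (k + 1) x) x := by
  intro k hk x hx
  interval_cases k
  · exact ((h.hasDerivAt x hx).const_sub c).congr_deriv (neg_neg _)
  · exact h.hasDerivAt_slope x hx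
  · exact h.hasDerivAt_D2 hm hx
  · exact h.hasDerivAt_D3 hm hx

theorem continuousOn_jet (h : IsProfile m δ Y W) (hm : 0 ≤ m) (c : ℝ) :
    ContinuousOn (profileJet m c Y W 4) (Ici 0) := by
  intro x hx
  have hY := (h.hasDerivAt x hx).continuousAt
  have hW := (h.hasDerivAt_slope x hx).continuousAt
  have h2 := (h.hasDerivAt_D2 hm hx).continuousAt
  have h3 := (h.hasDerivAt_D3 hm hx).continuousAt
  refine ContinuousAt.continuousWithinAt ?_
  change ContinuousAt (fun x => profileD4 m (Y x) (W x)) x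
  unfold profileD4
  exact ContinuousAt.div (by fun_prop) (by fun_prop) (h.add_pos hm hx).ne'

theorem contDiffOn (h : IsProfile m δ Y W) (hm : 0 ≤ m) :
    ContDiffOn ℝ 4 (fun x => -m - Y x) (Ici 0) :=
  contDiffOn_of_hasDerivAt (n := 4) (h.hasDerivAt_jet hm (-m)) (h.continuousOn_jet hm (-m))

theorem halfLineDeriv_eq_jet (h : IsProfile m δ Y W) (hm : 0 ≤ m) (c : ℝ) {k : ℕ} (hk : k ≤ 4)
    {x : ℝ} (hx : 0 ≤ x) :
    halfLineDeriv k (fun x => c - Y x) x = profileJet m c Y W k x :=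
  halfLineDeriv_eq (h.hasDerivAt_jet hm c) k hk x hx

/-- The successive derivatives of the flux `q` that belongs to a profile. -/
noncomputable def fluxJet (m : ℝ) (Y W : ℝ → ℝ) : ℕ → ℝ → ℝ
  | 0 => fun x => -(Y x * (Y x + 2 * m) / 2)
  | 1 => fun x => (Y x + m) * W x
  | 2 => fun x => W x - Y x * (Y x + 2 * m) / 2
  | _ => fun _ => 0

theorem hasDerivAt_fluxJet (h : IsProfile m δ Y W) (hm : 0 ≤ m) :
    ∀ k < 2, ∀ x, 0 ≤ x → HasDerivAt (fluxJet m Y W k) (fluxJet m Y W (k + 1) x) x := by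
  intro k hk x hx
  have hY := h.hasDerivAt x hx
  have hW := h.hasDerivAt_slope x hx
  have hp := h.add_pos hm hx
  interval_cases k
  · refine ((hY.mul (hY.add_const (2 * m))).div_const 2).neg.congr_deriv ?_
    simp only [fluxJet]
    ring
  · refine ((hY.add_const m).mul hW).congr_deriv ?_
    simp only [fluxJet]
    field_simp
    ring

theorem isStationarySolution (h : IsProfile m δ Y W) (hm : 0 ≤ m) :
    IsStationarySolution (-m - δ) (-m) (fun x => -m - Y x)
      (fun x => -(Y x * (Y x + 2 * m) / 2)) := by
  have hq := halfLineDeriv_eq (h.hasDerivAt_fluxJet hm)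
  have ht := h.tendsto_zero hm
  refine ⟨(h.contDiffOn hm).of_le (by norm_num), ?_, fun x hx => ?_, fun x hx => ?_, ?_, ?_, ?_⟩
  · refine contDiffOn_of_hasDerivAt (n := 2) (h.hasDerivAt_fluxJet hm) fun x hx => ?_
    have hY := (h.hasDerivAt x hx).continuousAt
    have hW := (h.hasDerivAt_slope x hx).continuousAt
    refine ContinuousAt.continuousWithinAt ?_
    change ContinuousAt (fun x => W x - Y x * (Y x + 2 * m) / 2) x
    fun_prop
  · have h1 := hq 1 (by norm_num) x hx
    simp only [fluxJet] at h1
    rw [h1, halfLineDeriv, iteratedDerivWithin_one]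
    have h2 := (((h.hasDerivAt x hx).const_sub (-m)).pow 2).div_const 2
    refine (h2.hasDerivWithinAt.derivWithin (uniqueDiffOn_Ici 0 x hx)).trans ?_
    norm_num
    ring
  · have h2 := hq 2 le_rfl x hx
    simp only [fluxJet] at h2
    rw [h2, h.halfLineDeriv_eq_jet hm _ (by norm_num) hx]
    simp only [profileJet]
    ring
  · simp only [h.zero]
  · simpa using ht.const_sub (-m)
  · simpa using ((ht.mul (ht.add_const (2 * m))).div_const 2).neg

end IsProfile

/-! ### Uniform estimates and conclusion -/

theorem abs_sq_div_le {a w c e : ℝ} (hw : 0 < w) (h : a ^ 2 ≤ c * e * w) :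
    |a ^ 2 / w| ≤ c * e := by
  rw [abs_of_nonneg (by positivity), div_le_iff₀ hw]
  exact h

theorem abs_div_le_mul {a w c e : ℝ} (hw : 0 < w) (h : |a| ≤ c * e * w) : |a / w| ≤ c * e := by
  rw [abs_div, abs_of_pos hw, div_le_iff₀ hw]
  exact h

theorem exists_estimates_of_pos {m : ℝ} (hm : 0 < m) (M : ℝ) :
    ∃ C, 0 < C ∧ ∀ δ Y W, IsProfile m δ Y W → δ ≤ M → ∀ x, 0 ≤ x →
      (∀ k ≤ 3, |profileJet m 0 Y W k x| ≤
        C * δ * Real.exp (-(min (1 / 2) (m / 2) * x))) ∧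
      |profileD2 m (Y x) (W x) ^ 2 / W x| ≤ C * δ ∧
      |profileD3 m (Y x) (W x) ^ 2 / W x| ≤ C * δ := by
  obtain ⟨C, hC, hb⟩ := exists_profileD_bound_of_pos hm M
  set l := min (1 / 2) (m / 2)
  have hl : 0 < l := by positivity
  refine ⟨C + 1 + C ^ 2 / l, by positivity, fun δ Y W h hδM x hx => ?_⟩
  have hδ := h.delta_pos
  have hy := h.pos x hx
  have hyδ := h.le x hx
  have hw := h.slope_pos hm.le hx
  have hwy := h.slope_le x hx
  have hlw : l * Y x ≤ W x := h.le_slope hm x hx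
  have hexp := h.le_exp hm hx
  have hC2 : 0 ≤ C ^ 2 / l := by positivity
  obtain ⟨b2, b3⟩ := hb _ _ hy (hyδ.trans hδM) hw.le hwy
  have hsq : ∀ a : ℝ, |a| ≤ C * Y x → a ^ 2 ≤ (C + 1 + C ^ 2 / l) * δ * W x := fun a ha => by
    calc a ^ 2 = |a| ^ 2 := (sq_abs a).symm
      _ ≤ (C * Y x) ^ 2 := by gcongr
      _ = C ^ 2 / l * Y x * (l * Y x) := by field_simp
      _ ≤ (C + 1 + C ^ 2 / l) * δ * W x := by
        gcongr
        linarith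
  refine ⟨fun k hk => ?_, abs_sq_div_le hw (hsq _ b2), abs_sq_div_le hw (hsq _ b3)⟩
  have key : |profileJet m 0 Y W k x| ≤ (C + 1 + C ^ 2 / l) * Y x := by
    interval_cases k
    · simp only [profileJet, zero_sub, abs_neg, abs_of_pos hy]
      nlinarith
    · simp only [profileJet, abs_of_pos hw]
      nlinarith
    · exact b2.trans (by gcongr; linarith)
    · exact b3.trans (by gcongr; linarith)
  rw [mul_assoc]
  exact key.trans (by gcongr)

theorem exists_estimates_of_zero {M : ℝ} (hM : 0 < M) :
    ∃ C, 0 < C ∧ ∀ δ Y W, IsProfile 0 δ Y W → δ ≤ M → ∀ x, 0 ≤ x →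
      (∀ k ≤ 4, |profileJet 0 0 Y W k x| ≤ C * (δ ^ (k + 1) / (1 + δ * x) ^ (k + 1))) ∧
      |profileD2 0 (Y x) (W x) ^ 2 / W x| ≤ C * δ ∧
      |profileD3 0 (Y x) (W x) ^ 2 / W x| ≤ C * δ ∧
      |profileD3 0 (Y x) (W x) / W x| ≤ C * δ ∧
      |profileD4 0 (Y x) (W x) / W x| ≤ C * δ := by
  obtain ⟨C, hC, hb⟩ := exists_profileD_bound_of_zero M
  set l := 1 / (4 * (M + 1)) with hl_def
  have hl : 0 < l := by positivity
  have hl1 : l ≤ 1 := by rw [hl_def, div_le_one (by positivity)]; linarith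
  -- One summand per estimate. Surplus powers of Y are bounded by M, one factor Y by δ, and Y² is
  -- absorbed by W ≥ lY².
  set K := (C + 1) / l ^ 5 + C ^ 2 / l * M ^ 3 + C ^ 2 / l * M ^ 5 + C / l * M + C / l * M ^ 2
    with hK
  have t1 : 0 < (C + 1) / l ^ 5 := by positivity
  have t2 : 0 ≤ C ^ 2 / l * M ^ 3 := by positivity
  have t3 : 0 ≤ C ^ 2 / l * M ^ 5 := by positivity
  have t4 : 0 ≤ C / l * M := by positivity
  have t5 : 0 ≤ C / l * M ^ 2 := by positivity
  refine ⟨K, by positivity, fun δ Y W h hδM x hx => ?_⟩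
  have hδ := h.delta_pos
  have hy := h.pos x hx
  have hyδ := h.le x hx
  have hyM := hyδ.trans hδM
  have hw := h.slope_pos le_rfl hx
  have hlδ : l ≤ 1 / (4 * (δ + 1)) := by rw [hl_def]; gcongr
  have hlw : l * Y x ^ 2 ≤ W x := le_trans (by gcongr) (h.le_slope_zero rfl x hx)
  have hdec : Y x ≤ l⁻¹ * (δ / (1 + δ * x)) := by
    refine (h.le_div_of_zero hl hlδ hx).trans ?_
    rw [← div_eq_inv_mul, div_div]
    refine div_le_div_of_nonneg_left hδ.le (by positivity) ?_
    have : 0 ≤ δ * x := by positivity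
    nlinarith
  obtain ⟨r, hr, hexp⟩ := h.slope_expansion rfl x hx
  obtain ⟨b1, b2, b3, b4⟩ := hb _ _ _ hy hyM hr hexp
  refine ⟨fun k hk => ?_, ?_, ?_, ?_, ?_⟩
  · have key : |profileJet 0 0 Y W k x| ≤ (C + 1) * Y x ^ (k + 1) := by
      have hC1 : C ≤ C + 1 := by linarith
      interval_cases k
      · simp only [profileJet, zero_sub, abs_neg, abs_of_pos hy, zero_add, pow_one]
        nlinarith [mul_nonneg hC hy.le]
      · exact b1.trans (by gcongr)
      · exact b2.trans (by gcongr)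
      · exact b3.trans (by gcongr)
      · exact b4.trans (by gcongr)
    refine key.trans ?_
    have hD : 0 ≤ δ / (1 + δ * x) := by positivity
    calc (C + 1) * Y x ^ (k + 1)
        ≤ (C + 1) * (l⁻¹ * (δ / (1 + δ * x))) ^ (k + 1) := by gcongr
      _ = (C + 1) * l⁻¹ ^ (k + 1) * (δ ^ (k + 1) / (1 + δ * x) ^ (k + 1)) := by
        rw [mul_pow, div_pow, mul_assoc]
      _ ≤ K * (δ ^ (k + 1) / (1 + δ * x) ^ (k + 1)) := by
        gcongr
        calc (C + 1) * l⁻¹ ^ (k + 1) ≤ (C + 1) * l⁻¹ ^ 5 := by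
              gcongr
              · exact (one_le_inv₀ hl).2 hl1
              · omega
          _ = (C + 1) / l ^ 5 := by rw [inv_pow, div_eq_mul_inv]
          _ ≤ K := by linarith
  · refine abs_sq_div_le hw ?_
    calc profileD2 0 (Y x) (W x) ^ 2 = |profileD2 0 (Y x) (W x)| ^ 2 := (sq_abs _).symm
      _ ≤ (C * Y x ^ 3) ^ 2 := by gcongr
      _ = C ^ 2 / l * Y x ^ 3 * Y x * (l * Y x ^ 2) := by field_simp
      _ ≤ C ^ 2 / l * M ^ 3 * δ * W x := by gcongr
      _ ≤ K * δ * W x := by gcongr; linarith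
  · refine abs_sq_div_le hw ?_
    calc profileD3 0 (Y x) (W x) ^ 2 = |profileD3 0 (Y x) (W x)| ^ 2 := (sq_abs _).symm
      _ ≤ (C * Y x ^ 4) ^ 2 := by gcongr
      _ = C ^ 2 / l * Y x ^ 5 * Y x * (l * Y x ^ 2) := by field_simp
      _ ≤ C ^ 2 / l * M ^ 5 * δ * W x := by gcongr
      _ ≤ K * δ * W x := by gcongr; linarith
  · refine abs_div_le_mul hw ?_
    calc |profileD3 0 (Y x) (W x)| ≤ C * Y x ^ 4 := b3
      _ = C / l * Y x * Y x * (l * Y x ^ 2) := by field_simp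
      _ ≤ C / l * M * δ * W x := by gcongr
      _ ≤ K * δ * W x := by gcongr; linarith
  · refine abs_div_le_mul hw ?_
    calc |profileD4 0 (Y x) (W x)| ≤ C * Y x ^ 5 := b4
      _ = C / l * Y x ^ 2 * Y x * (l * Y x ^ 2) := by field_simp
      _ ≤ C / l * M ^ 2 * δ * W x := by gcongr
      _ ≤ K * δ * W x := by gcongr; linarith

theorem mainTheorem4 (up : ℝ) (hup : up ≤ 0) :
    ∃ (u q : ℝ → ℝ → ℝ) (lam : ℝ), 0 < lam ∧
      -- `u um`, `q um` is the solution with boundary value `um`; (i) it is increasing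
      (∀ um : ℝ, um < up →
        IsStationarySolution um up (u um) (q um) ∧
        ContDiffOn ℝ 4 (u um) (Set.Ici 0) ∧
        ∀ x : ℝ, 0 ≤ x → 0 < halfLineDeriv 1 (u um) x) ∧
      -- quantitative estimates; `C` depends only on `up` and on an upper bound `M` of `δ`
      (∀ M : ℝ, 0 < M → ∃ C : ℝ, 0 < C ∧
        ∀ um δ : ℝ, um < up → δ = |um - up| → δ ≤ M → ∀ x : ℝ, 0 ≤ x →
          -- (ii)
          (up < 0 → ∀ k : ℕ, k ≤ 3 →
            |halfLineDeriv k (fun y => u um y - up) x| ≤ C * δ * Real.exp (-(lam * x))) ∧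
          -- (iii)
          (up = 0 → ∀ k : ℕ, k ≤ 4 →
            |halfLineDeriv k (u um) x| ≤ C * (δ ^ (k + 1) / (1 + δ * x) ^ (k + 1))) ∧
          -- (iv)
          |halfLineDeriv 2 (u um) x ^ 2 / halfLineDeriv 1 (u um) x| ≤ C * δ ∧
          |halfLineDeriv 3 (u um) x ^ 2 / halfLineDeriv 1 (u um) x| ≤ C * δ ∧
          -- (v)
          (up = 0 →
            |halfLineDeriv 3 (u um) x / halfLineDeriv 1 (u um) x| ≤ C * δ ∧
            |halfLineDeriv 4 (u um) x / halfLineDeriv 1 (u um) x| ≤ C * δ)) := by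
  obtain ⟨m, rfl⟩ : ∃ m, up = -m := ⟨-up, (neg_neg up).symm⟩
  have hm : 0 ≤ m := by linarith
  have hex : ∀ um : ℝ, ∃ Y W, um < -m → IsProfile m (-m - um) Y W := fun um => by
    by_cases hum : um < -m
    · obtain ⟨Y, W, h⟩ := exists_isProfile hm (show 0 < -m - um by linarith)
      exact ⟨Y, W, fun _ => h⟩
    · exact ⟨0, 0, fun h => absurd h hum⟩
  choose Y W hYW using hex
  have hjet : ∀ um, um < -m → ∀ k ≤ 4, ∀ x, 0 ≤ x →
      halfLineDeriv k (fun y => -m - Y um y) x = profileJet m (-m) (Y um) (W um) k x :=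
    fun um hum k hk x hx => (hYW um hum).halfLineDeriv_eq_jet hm (-m) hk hx
  refine ⟨fun um x => -m - Y um x, fun um x => -(Y um x * (Y um x + 2 * m) / 2),
    -- The exponential estimate is vacuous for m = 0, where the minimum would vanish; 1 is an
    -- arbitrary positive value.
    if m = 0 then 1 else min (1 / 2) (m / 2), ?_, fun um hum => ⟨?_, ?_, fun x hx => ?_⟩,
    fun M hM => ?_⟩
  · split_ifs with h
    · exact one_pos
    · have : 0 < m := lt_of_le_of_ne hm (Ne.symm h)
      positivity
  · simpa using (hYW um hum).isStationarySolution hm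
  · exact (hYW um hum).contDiffOn hm
  · rw [hjet um hum 1 (by norm_num) x hx]
    exact (hYW um hum).slope_pos hm hx
  · rcases hm.eq_or_lt with rfl | hpos
    · obtain ⟨C, hC, hest⟩ := exists_estimates_of_zero hM
      refine ⟨C, hC, fun um δ hum hδ hδM x hx => ?_⟩
      have hδ' : δ = -0 - um := by rw [hδ, abs_of_neg (by linarith)]; ring
      obtain ⟨h1, h2, h3, h4, h5⟩ := hest δ _ _ (hδ' ▸ hYW um hum) hδM x hx
      rw [hjet um hum 1 (by norm_num) x hx, hjet um hum 2 (by norm_num) x hx,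
        hjet um hum 3 (by norm_num) x hx, hjet um hum 4 (by norm_num) x hx]
      refine ⟨fun h => absurd h (by simp), fun _ k hk => ?_, h2, h3, fun _ => ⟨h4, h5⟩⟩
      rw [hjet um hum k hk x hx, neg_zero]
      exact h1 k hk
    · obtain ⟨C, hC, hest⟩ := exists_estimates_of_pos hpos M
      refine ⟨C, hC, fun um δ hum hδ hδM x hx => ?_⟩
      have hδ' : δ = -m - um := by rw [hδ, abs_of_neg (by linarith)]; ring
      obtain ⟨h1, h2, h3⟩ := hest δ _ _ (hδ' ▸ hYW um hum) hδM x hx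
      rw [hjet um hum 1 (by norm_num) x hx, hjet um hum 2 (by norm_num) x hx,
        hjet um hum 3 (by norm_num) x hx, if_neg hpos.ne']
      refine ⟨fun _ k hk => ?_, fun h => absurd h (by linarith), h2, h3,
        fun h => absurd h (by linarith)⟩
      have hfun : (fun y => -m - Y um y - -m) = fun y => 0 - Y um y := by ext y; ring
      rw [hfun, (hYW um hum).halfLineDeriv_eq_jet hm 0 (by omega) hx]
      exact h1 k hk
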